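/- Let $(\overline M,\overline g)$ be a pseudo-Riemannian manifold of dimension $n+2$ and let $(M,g_0)$ be a totally geodesic lightlike hypersurface of it: $g_0$ is the induced metric, its kernel $TM^\perp$ has rank one, and the second fundamental form of $M$ vanishes. Let $S(TM)$ be an integrable screen distribution, that is, $TM=S(TM)\oplus TM^\perp$. Let $c$ be the set of metrics $e^{-2f}g_0$ with $f$ smooth and $df=0$ on $TM^\perp$. Let $D$ be a Weyl screen structure: a torsion-free linear connection on $M$ such that for each $g\in c$ there is a unique $1$-form $\theta_g$ with $Dg=-2\theta_g\otimes g$, and such that $S(TM)$ is $D$-parallel. Let $g\in c$ and let $U\subseteq M$ be open. Let $\xi$ be a nowhere zero smooth section of $TM^\perp$ over $U$ with $D_\xi\xi=0$, and let $N$ be the transversal field along $U$ with $\overline g(N,\xi)=1$ and $\overline g(N,N)=\overline g(N,W)=0$ for $W\in S(TM)$. Put $\eta=\overline g(N,\cdot)$ on $TM$. Let $D^g$ be a torsion-free connection over $U$ with $D^gg=0$ and $D^g_\xi\xi=0$. Let $\theta_g^\sharp$ be the vector field with $g(\theta_g^\sharp,\cdot)+\eta(\theta_g^\sharp)\,\eta=\theta_g$,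 and put $|\theta_g^\sharp|_g^2=g(\theta_g^\sharp,\theta_g^\sharp)$. Let $\delta^g\theta_g$ be the trace of $Z\mapsto D^g_Z\theta_g^\sharp$. Normalise $d\theta_g$ by $2\,d\theta_g(X,Y)=X\theta_g(Y)-Y\theta_g(X)-\theta_g([X,Y])$. For a connection $\nabla$ put $R^\nabla(X,Y)=\nabla_{[X,Y]}-[\nabla_X,\nabla_Y]$, let $\mathrm{Ric}^\nabla(X,Y)$ be the trace of $Z\mapsto R^\nabla(X,Z)Y$, and write $\mathrm{Ric}^g=\mathrm{Ric}^{D^g}$. Then, over $U$, $\theta_g(\xi)=0$, the field $\theta_g^\sharp$ is a section of $S(TM)$ with $g(\theta_g^\sharp,\cdot)=\theta_g$, one has $D^g_X\xi=\varphi_g(X)\xi$ for the $1$-form $\varphi_g(X)=\eta(D^g_X\xi)$, and $$D_XY=D^g_XY+\theta_g(X)Y+\theta_g(Y)X-g(X,Y)\theta_g^\sharp-S(X,Y)\xi$$ for the symmetric bilinear form $S(X,Y)=-\eta\big(D_XY-D^g_XY-\theta_g(X)Y-\theta_g(Y)X+g(X,Y)\theta_g^\sharp\big)$, which satisfies $S(\xi,\xi)=0$.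 Moreover, for all smooth vector fields $X,Y$ on $U$, $$\begin{aligned}\mathrm{Ric}^D(X,Y)={}&\mathrm{Ric}^g(X,Y)-2\,d\theta_g(X,Y)+(1-n)(D^g_X\theta_g)(Y)+(n-1)\theta_g(X)\theta_g(Y)\\&+(1-n)g(X,Y)|\theta_g^\sharp|_g^2-g(X,Y)\,\delta^g\theta_g+(D^g_XS)(\xi,Y)-(D^g_\xi S)(X,Y)\\&+g(X,Y)S(\xi,\theta_g^\sharp)-S(\xi,X)S(\xi,Y)+\varphi_g(X)S(\xi,Y).\end{aligned}$$ -/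

import Mathlib

open Bundle VectorField
open scoped Manifold ContDiff Topology

noncomputable section

namespace WeylScreen

section Generic

/-! ### Tensor fields, connections, curvature on a manifold `M` -/

variable {E : Type*} [NormedAddCommGroup E] [NormedSpace ℝ E]
  {H : Type*} [TopologicalSpace H] (I : ModelWithCorners ℝ E H)
  (M : Type*) [TopologicalSpace M] [ChartedSpace H M]

/-- Vector fields (no regularity required). -/
abbrev VField : Type _ := Π x : M, TangentSpace I x

/-- Fields of `1`-forms (no regularity required). -/
abbrev OneForm : Type _ := Π x : M, TangentSpace I x →L[ℝ] ℝ

/-- Fields of bilinear forms (no regularity required). -/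
abbrev BilinField : Type _ := Π x : M, TangentSpace I x →L[ℝ] TangentSpace I x →L[ℝ] ℝ

/-- Operators on vector fields of the type of a linear connection: `D Y x v` is `(D_v Y)(x)`. -/
abbrev Conn : Type _ := (Π x : M, TangentSpace I x) →
  Π x : M, TangentSpace I x →L[ℝ] TangentSpace I x

variable {I M} [IsManifold I ∞ M]

/-- `X` is smooth on the set `U`. -/
def SmoothField (U : Set M) (X : VField I M) : Prop :=
  ContMDiffOn I I.tangent ∞ (fun x ↦ (⟨x, X x⟩ : TangentBundle I M)) U

/-- `X` is differentiable at `x`. -/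
def DiffAt (x : M) (X : VField I M) : Prop :=
  MDifferentiableAt I I.tangent (fun y ↦ (⟨y, X y⟩ : TangentBundle I M)) x

/-- The directional derivative `v · f` of a function. -/
def dirDeriv (f : M → ℝ) (x : M) (v : TangentSpace I x) : ℝ := mvfderiv I f x v

/-- The covariant derivative `(D_X θ)(Y) = X · θ(Y) - θ(D_X Y)` of a `1`-form. -/
def covDerivForm (D : Conn I M) (θ : OneForm I M) (X Y : VField I M) (x : M) : ℝ :=
  dirDeriv (fun y ↦ θ y (Y y)) x (X x) - θ x (D Y x (X x))

/-- The covariant derivative `(D_Z B)(X, Y) = Z · B(X, Y) - B(D_Z X, Y) - B(X, D_Z Y)`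
of a field of bilinear forms. -/
def covDerivBilin (D : Conn I M) (B : Π x : M, TangentSpace I x → TangentSpace I x → ℝ)
    (Z X Y : VField I M) (x : M) : ℝ :=
  dirDeriv (fun y ↦ B y (X y) (Y y)) x (Z x) - B x (D X x (Z x)) (Y x) - B x (X x) (D Y x (Z x))

/-- The exterior derivative of a `1`-form, normalised by
`2 dθ(X, Y) = X · θ(Y) - Y · θ(X) - θ([X, Y])`. -/
def extDerivHalf (θ : OneForm I M) (X Y : VField I M) (x : M) : ℝ :=
  (1 / 2) * (dirDeriv (fun y ↦ θ y (Y y)) x (X x) - dirDeriv (fun y ↦ θ y (X y)) x (Y x)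
    - θ x (mlieBracket I X Y x))

/-- The curvature `R^D(X, Y) Z = D_{[X,Y]} Z - [D_X, D_Y] Z`. -/
def curvature (D : Conn I M) (X Y Z : VField I M) (x : M) : TangentSpace I x :=
  D Z x (mlieBracket I X Y x)
    - (D (fun y ↦ D Z y (Y y)) x (X x) - D (fun y ↦ D Z y (X y)) x (Y x))

/-- `θ` is a smooth `1`-form on `U`. -/
def SmoothForm (U : Set M) (θ : OneForm I M) : Prop :=
  ContMDiffOn I (I.prod 𝓘(ℝ, E →L[ℝ] ℝ)) ∞
    (fun x ↦ TotalSpace.mk' (E →L[ℝ] ℝ) (E := fun x : M ↦ TangentSpace I x →L[ℝ] ℝ) x (θ x)) U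

/-- `g` is a smooth field of bilinear forms. -/
def SmoothBilin (g : BilinField I M) : Prop :=
  ContMDiff I (I.prod 𝓘(ℝ, E →L[ℝ] E →L[ℝ] ℝ)) ∞
    (fun x ↦ TotalSpace.mk' (E →L[ℝ] E →L[ℝ] ℝ)
      (E := fun x : M ↦ TangentSpace I x →L[ℝ] TangentSpace I x →L[ℝ] ℝ) x (g x))

/-- `D` is a smooth linear connection over the open set `U`. -/
structure IsConnectionOn (U : Set M) (D : Conn I M) : Prop where
  isCov : IsCovariantDerivativeOn E D U
  smooth : ∀ V : Set M, IsOpen V → V ⊆ U → ContMDiffCovariantDerivativeOn E ∞ D V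

theorem IsConnectionOn.mono {D : Conn I M} (hD : IsConnectionOn Set.univ D) (U : Set M) :
    IsConnectionOn U D where
  isCov := hD.isCov.mono (Set.subset_univ U)
  smooth V hV _ := hD.smooth V hV (Set.subset_univ V)

/-- `D` is torsion-free over `U`: `D_X Y - D_Y X = [X, Y]`. -/
def TorsionFreeOn (U : Set M) (D : Conn I M) : Prop :=
  ∀ x ∈ U, ∀ X Y : VField I M, DiffAt x X → DiffAt x Y →
    D Y x (X x) - D X x (Y x) = mlieBracket I X Y x

/-- `(D_X g)(Y, Z) = -2 θ(X) g(Y, Z)` over `U`. -/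
def WeylRelationOn (U : Set M) (D : Conn I M) (g : BilinField I M) (θ : OneForm I M) : Prop :=
  ∀ x ∈ U, ∀ X Y Z : VField I M, DiffAt x X → DiffAt x Y → DiffAt x Z →
    covDerivBilin D (fun y u v ↦ g y u v) X Y Z x = -2 * θ x (X x) * g x (Y x) (Z x)

/-- `D` is `g`-compatible over `U`: `D g = 0`. -/
def MetricOn (U : Set M) (D : Conn I M) (g : BilinField I M) : Prop :=
  ∀ x ∈ U, ∀ X Y Z : VField I M, DiffAt x X → DiffAt x Y → DiffAt x Z →
    covDerivBilin D (fun y u v ↦ g y u v) X Y Z x = 0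

/-- `g` is a pseudo-Riemannian metric: a smooth field of nondegenerate symmetric bilinear forms. -/
structure IsPseudoRiemannian (g : BilinField I M) : Prop where
  smooth : SmoothBilin g
  symm : ∀ x u v, g x u v = g x v u
  nondeg : ∀ x u, (∀ v, g x u v = 0) → u = 0

/-- `D` is the Levi-Civita connection of `g`. -/
structure IsLeviCivita (g : BilinField I M) (D : Conn I M) : Prop where
  isConn : IsConnectionOn Set.univ D
  torsionFree : TorsionFreeOn Set.univ D
  metric : MetricOn Set.univ D g

section Tensorial

/-- For a smooth connection and smooth `X`, `Y`, the map `Z ↦ R^D(X, Z) Y` is tensorial, so that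
it is induced by an endomorphism of each tangent space. -/
theorem curvature_tensorial [CompleteSpace E] {U : Set M} (hU : IsOpen U) {D : Conn I M}
    (hD : IsConnectionOn U D) {X Y : VField I M} (hX : SmoothField U X) (hY : SmoothField U Y)
    {x : M} (hx : x ∈ U) :
    TensorialAt I E (fun Z : Π y : M, TangentSpace I y ↦ curvature D X Z Y x) x := by
  have hXx : MDiffAt (T% X) x := (hX.contMDiffAt (hU.mem_nhds hx)).mdifferentiableAt (by simp)
  have hcY : ContMDiffOn I (I.prod 𝓘(ℝ, E →L[ℝ] E)) ∞
      (fun y ↦ TotalSpace.mk' (E →L[ℝ] E)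
        (E := fun y : M ↦ TangentSpace I y →L[ℝ] TangentSpace I y) y (D Y y)) U :=
    (hD.smooth U hU subset_rfl).contMDiff hY
  have hcYx := (hcY.contMDiffAt (hU.mem_nhds hx)).mdifferentiableAt (by simp)
  have hD1 {Z : VField I M} (hZ : MDiffAt (T% Z) x) : MDiffAt (T% (fun y ↦ D Y y (Z y))) x :=
    hcYx.clm_bundle_apply hZ
  constructor
  · intro f Z hf hZ
    have e : (fun y ↦ D Y y ((f • Z) y)) = f • (fun y ↦ D Y y (Z y)) := by
      funext y; simp
    simp only [curvature]
    rw [e, hD.isCov.leibniz (hD1 hZ) hf hx, mlieBracket_smul_right hf hZ]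
    simp
    module
  · intro Z Z' hZ hZ'
    have e : (fun y ↦ D Y y ((Z + Z') y)) = (fun y ↦ D Y y (Z y)) + (fun y ↦ D Y y (Z' y)) := by
      funext y; simp
    simp only [curvature]
    rw [e, hD.isCov.add (hD1 hZ) (hD1 hZ') hx, mlieBracket_add_right hZ hZ']
    simp
    module

variable [FiniteDimensional ℝ E]

open scoped Classical in
/-- The endomorphism `Z ↦ R^D(X, Z) Y` of the tangent space at `x`; it is defined as soon as this
expression depends tensorially on `Z`, see `curvature_tensorial`. -/
def ricciEndo (D : Conn I M) (X Y : VField I M) (x : M) :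
    TangentSpace I x →L[ℝ] TangentSpace I x :=
  if h : TensorialAt I E (fun Z : Π y : M, TangentSpace I y ↦ curvature D X Z Y x) x then
    TensorialAt.mkHom _ x h
  else 0

/-- The Ricci curvature `Ric^D(X, Y)`: the trace of `Z ↦ R^D(X, Z) Y`. -/
def ricci (D : Conn I M) (X Y : VField I M) (x : M) : ℝ :=
  LinearMap.trace ℝ (TangentSpace I x) (ricciEndo D X Y x : TangentSpace I x →ₗ[ℝ] TangentSpace I x)

/-- The defining property of the endomorphism whose trace is `Ric^D(X, Y)`. -/
theorem ricciEndo_apply {U : Set M} (hU : IsOpen U) {D : Conn I M}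
    (hD : IsConnectionOn U D) {X Y Z : VField I M} (hX : SmoothField U X) (hY : SmoothField U Y)
    {x : M} (hx : x ∈ U) (hZ : DiffAt x Z) :
    ricciEndo D X Y x (Z x) = curvature D X Z Y x := by
  have : CompleteSpace E := FiniteDimensional.complete ℝ E
  have h := curvature_tensorial hU hD hX hY hx
  rw [ricciEndo, dif_pos h]
  exact TensorialAt.mkHom_apply h hZ

end Tensorial

/-! ### Degenerate metrics, screens, Weyl structures -/

/-- The radical `Rad T_xM = T_xM^⊥ ∩ T_xM`, the kernel of `g`. -/
def rad (g : BilinField I M) (x : M) : Submodule ℝ (TangentSpace I x) :=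
  LinearMap.ker (g x : TangentSpace I x →ₗ[ℝ] TangentSpace I x →L[ℝ] ℝ)

/-- The conformal structure `[g₀]₀`: the metrics `e^{-2f} g₀` with `f` smooth and constant
along the radical directions. -/
def nullConformalClass (g₀ : BilinField I M) : Set (BilinField I M) :=
  {g | ∃ f : M → ℝ, ContMDiff I 𝓘(ℝ, ℝ) ∞ f ∧ (∀ x, ∀ u ∈ rad g₀ x, dirDeriv f x u = 0) ∧
    ∀ x, g x = Real.exp (-2 * f x) • g₀ x}

/-- A screen distribution: a smooth rank `k` distribution complementary to the radical. -/
structure IsScreen (k : ℕ) (g : BilinField I M) (Scr : Π x : M, Submodule ℝ (TangentSpace I x)) :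
    Prop where
  isCompl : ∀ x, IsCompl (Scr x) (rad g x)
  smooth : ∀ x₀ : M, ∃ V : Set M, IsOpen V ∧ x₀ ∈ V ∧ ∃ e : Fin k → VField I M,
    (∀ i, SmoothField V (e i)) ∧
      ∀ x ∈ V, LinearIndependent ℝ (fun i ↦ e i x) ∧
        Scr x = Submodule.span ℝ (Set.range fun i ↦ e i x)

/-- Integrability of a distribution, in involutive (Frobenius) form: the bracket of two smooth
local sections is a section. -/
def Integrable (Scr : Π x : M, Submodule ℝ (TangentSpace I x)) : Prop :=
  ∀ V : Set M, IsOpen V → ∀ X Y : VField I M, SmoothField V X → SmoothField V Y →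
    (∀ x ∈ V, X x ∈ Scr x) → (∀ x ∈ V, Y x ∈ Scr x) → ∀ x ∈ V, mlieBracket I X Y x ∈ Scr x

/-- A Weyl structure relative to `(M, [g₀]₀)`. -/
structure IsWeylStructure (g₀ : BilinField I M) (D : Conn I M) : Prop where
  isConn : IsConnectionOn Set.univ D
  torsionFree : TorsionFreeOn Set.univ D
  weyl : ∀ g ∈ nullConformalClass g₀, ∃! θ : OneForm I M,
    SmoothForm Set.univ θ ∧ WeylRelationOn Set.univ D g θ

/-- A Weyl screen structure relative to `(M, [g₀]₀, Scr)`: a Weyl structure for which `Scr` is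
parallel. -/
structure IsWeylScreenStructure (g₀ : BilinField I M)
    (Scr : Π x : M, Submodule ℝ (TangentSpace I x)) (D : Conn I M) : Prop
    extends IsWeylStructure g₀ D where
  parallel : ∀ (x : M) (Y : VField I M), DiffAt x Y → (∀ᶠ y in 𝓝 x, Y y ∈ Scr y) →
    ∀ u : TangentSpace I x, D Y x u ∈ Scr x

/-- `θ` is the `1`-form `θ_g` associated with the pair `{D, g}`. -/
structure IsWeylForm (D : Conn I M) (g : BilinField I M) (θ : OneForm I M) :
    Prop where
  smooth : SmoothForm Set.univ θ
  relation : WeylRelationOn Set.univ D g θ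

/-- The connection `D^g`: over `U` it is torsion-free, `g`-compatible, and `D^g_ξ ξ = 0`. -/
structure IsAdaptedConnection (U : Set M) (g : BilinField I M)
    (ξ : VField I M) (Dg : Conn I M) : Prop where
  isConn : IsConnectionOn U Dg
  torsionFree : TorsionFreeOn U Dg
  metric : MetricOn U Dg g
  geodesic : ∀ x ∈ U, Dg ξ x (ξ x) = 0

/-- The isomorphism `X ↦ X^♭ = g(X, ·) + η(X) η`. -/
def flat (g : BilinField I M) (η : OneForm I M) (x : M) :
    TangentSpace I x →L[ℝ] TangentSpace I x →L[ℝ] ℝ :=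
  g x + (η x).smulRight (η x)

/-- The dual vector field `θ^♯`, `♯` being the inverse of `♭`. -/
def sharp (g : BilinField I M) (η : OneForm I M) (θ : OneForm I M) : VField I M :=
  fun x ↦ (flat g η x).inverse (θ x)

/-- The `1`-form `φ_g` defined by `D^g_X ξ = φ_g(X) ξ`, read off with `η(ξ) = 1`. -/
def phi (Dg : Conn I M) (η : OneForm I M) (ξ : VField I M) : OneForm I M :=
  fun x ↦ (η x).comp (Dg ξ x)

/-- `δ^g θ = div^g θ^♯`, the trace of `Z ↦ D^g_Z θ^♯`. -/
def codiff (Dg : Conn I M) (g : BilinField I M) (η θ : OneForm I M) (x : M) : ℝ :=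
  LinearMap.trace ℝ (TangentSpace I x)
    (Dg (sharp g η θ) x : TangentSpace I x →ₗ[ℝ] TangentSpace I x)

section Correction

variable [FiniteDimensional ℝ E]

/-- The bilinear form `S` of
`D_X Y = D^g_X Y + θ(X) Y + θ(Y) X - g(X, Y) θ^♯ - S(X, Y) ξ`: the opposite of the `ξ`-component
of `D_X Y - D^g_X Y - θ(X) Y - θ(Y) X + g(X, Y) θ^♯`. The tensor `D - D^g` is Mathlib's difference
of two covariant derivatives: `difference x v u = (D_u Y - D^g_u Y)(x)` whenever `Y x = v`. -/
def weylS {U : Set M} {D Dg : Conn I M} (hD : IsConnectionOn U D) (hDg : IsConnectionOn U Dg)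
    (g : BilinField I M) (η θ : OneForm I M) (x : M) (u v : TangentSpace I x) : ℝ :=
  -η x (hD.isCov.difference hDg.isCov x v u - θ x u • v - θ x v • u
    + g x u v • sharp g η θ x)

end Correction

end Generic

section Hypersurface

/-! ### Lightlike hypersurfaces of pseudo-Riemannian manifolds -/

variable {E : Type*} [NormedAddCommGroup E] [NormedSpace ℝ E]
  {H : Type*} [TopologicalSpace H] {I : ModelWithCorners ℝ E H}
  {M : Type*} [TopologicalSpace M] [ChartedSpace H M] [IsManifold I ∞ M]
  {E' : Type*} [NormedAddCommGroup E'] [NormedSpace ℝ E']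
  {H' : Type*} [TopologicalSpace H'] {J : ModelWithCorners ℝ E' H'}
  {M' : Type*} [TopologicalSpace M'] [ChartedSpace H' M'] [IsManifold J ∞ M']

/-- `(M, g₀)`, immersed in the pseudo-Riemannian manifold `(M', g')` by `ι`, is a lightlike
hypersurface: `g₀ = ι^* g'` has a radical of rank one at every point. (The codimension one is
expressed by the dimensions of `M` and `M'`.) -/
structure IsLightlikeHypersurface (g' : BilinField J M') (ι : M → M') (g₀ : BilinField I M) :
    Prop where
  immersion : Manifold.IsImmersion I J ∞ ι
  smooth : SmoothBilin g₀
  pullback : ∀ x u v, g₀ x u v = g' (ι x) (mfderiv I J ι x u) (mfderiv I J ι x v)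
  rank_rad : ∀ x, Module.finrank ℝ (rad g₀ x) = 1

variable (I) in
/-- `M` is totally geodesic in `M'` with Levi-Civita connection `D'`, i.e. its second fundamental
form vanishes: `D'_X Y` is tangent to `M` whenever `X`, `Y` are local fields of `M'` which are
tangent to `M` along `M`. -/
def IsTotallyGeodesic (D' : Conn J M') (ι : M → M') : Prop :=
  ∀ (x : M) (V : Set M'), IsOpen V → ι x ∈ V → ∀ X Y : VField J M',
    SmoothField V X → SmoothField V Y →
    (∀ᶠ y in 𝓝 x, X (ι y) ∈ Set.range (mfderiv I J ι y)) →
    (∀ᶠ y in 𝓝 x, Y (ι y) ∈ Set.range (mfderiv I J ι y)) →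
    D' Y (ι x) (X (ι x)) ∈ Set.range (mfderiv I J ι x)

/-- `{ξ, N}` is a normalizing pair over `U` for the lightlike hypersurface `(M, g₀)` with screen
distribution `Scr`: `ξ` is a nowhere zero smooth section of `T M^⊥`, and `N` is the smooth
transversal field along `M` with `g'(N, ξ) = 1` and `g'(N, N) = g'(N, W) = 0` for `W` in `Scr`. -/
structure IsNormalizingPair (g' : BilinField J M') (ι : M → M') (g₀ : BilinField I M)
    (Scr : Π x : M, Submodule ℝ (TangentSpace I x)) (U : Set M) (ξ : VField I M)
    (N : Π x : M, TangentSpace J (ι x)) : Prop where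
  xi_smooth : SmoothField U ξ
  xi_rad : ∀ x ∈ U, ξ x ∈ rad g₀ x
  xi_ne_zero : ∀ x ∈ U, ξ x ≠ 0
  N_smooth : ContMDiffOn I J.tangent ∞ (fun x ↦ (⟨ι x, N x⟩ : TangentBundle J M')) U
  N_xi : ∀ x ∈ U, g' (ι x) (N x) (mfderiv I J ι x (ξ x)) = 1
  N_N : ∀ x ∈ U, g' (ι x) (N x) (N x) = 0
  N_screen : ∀ x ∈ U, ∀ w ∈ Scr x, g' (ι x) (N x) (mfderiv I J ι x w) = 0

variable (I) in
/-- The `1`-form `η = g'(N, ·)` on `M`. -/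
def eta (g' : BilinField J M') (ι : M → M') (N : Π x : M, TangentSpace J (ι x)) : OneForm I M :=
  fun x ↦ (g' (ι x) (N x)).comp (mfderiv I J ι x)

end Hypersurface

end WeylScreen

end

open WeylScreen

noncomputable section

namespace WeylScreen

section Regularity

variable {E : Type*} [NormedAddCommGroup E] [NormedSpace ℝ E]
  {H : Type*} [TopologicalSpace H] {I : ModelWithCorners ℝ E H}
  {M : Type*} [TopologicalSpace M] [ChartedSpace H M] [IsManifold I ∞ M]
  {U : Set M} {x : M}

theorem SmoothField.contMDiffAt {X : VField I M} (hX : SmoothField U X) (hU : IsOpen U)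
    (hx : x ∈ U) : ContMDiffAt I I.tangent ∞ (fun y ↦ (⟨y, X y⟩ : TangentBundle I M)) x :=
  ContMDiffOn.contMDiffAt hX (hU.mem_nhds hx)

theorem SmoothField.diffAt {X : VField I M} (hX : SmoothField U X) (hU : IsOpen U)
    (hx : x ∈ U) : DiffAt x X :=
  (hX.contMDiffAt hU hx).mdifferentiableAt (by simp)

theorem IsConnectionOn.contMDiffOn {D : Conn I M} (hD : IsConnectionOn U D) (hU : IsOpen U)
    {Y : VField I M} (hY : SmoothField U Y) :
    ContMDiffOn I (I.prod 𝓘(ℝ, E →L[ℝ] E)) ∞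
      (fun y ↦ TotalSpace.mk' (E →L[ℝ] E)
        (E := fun y : M ↦ TangentSpace I y →L[ℝ] TangentSpace I y) y (D Y y)) U :=
  (hD.smooth U hU subset_rfl).contMDiff hY

theorem IsConnectionOn.diffAt {D : Conn I M} (hD : IsConnectionOn U D) (hU : IsOpen U)
    {Y Z : VField I M} (hY : SmoothField U Y) (hx : x ∈ U) (hZ : DiffAt x Z) :
    DiffAt x (fun y ↦ D Y y (Z y)) :=
  (((hD.contMDiffOn hU hY).contMDiffAt (hU.mem_nhds hx)).mdifferentiableAt
    (by simp)).clm_bundle_apply hZ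

theorem SmoothForm.contMDiffAt_apply {θ : OneForm I M} (hθ : SmoothForm Set.univ θ)
    {X : VField I M} (hX : ContMDiffAt I I.tangent ∞ (fun y ↦ (⟨y, X y⟩ : TangentBundle I M)) x) :
    ContMDiffAt I 𝓘(ℝ, ℝ) ∞ (fun y ↦ θ y (X y)) x := by
  have := (ContMDiffOn.contMDiffAt hθ Filter.univ_mem).clm_bundle_apply
    (E₂ := Bundle.Trivial M ℝ) hX
  rw [contMDiffAt_totalSpace] at this
  exact this.2

theorem SmoothForm.mdifferentiableAt_apply {θ : OneForm I M} (hθ : SmoothForm Set.univ θ)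
    {X : VField I M} (hX : DiffAt x X) :
    MDifferentiableAt I 𝓘(ℝ, ℝ) (fun y ↦ θ y (X y)) x := by
  have := ((ContMDiffOn.contMDiffAt hθ (x := x) Filter.univ_mem).mdifferentiableAt
    (by simp)).clm_bundle_apply (E₂ := Bundle.Trivial M ℝ) hX
  rw [mdifferentiableAt_totalSpace] at this
  exact this.2

theorem SmoothBilin.contMDiffAt_apply {g : BilinField I M} (hg : SmoothBilin g)
    {X Y : VField I M} (hX : ContMDiffAt I I.tangent ∞ (fun y ↦ (⟨y, X y⟩ : TangentBundle I M)) x)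
    (hY : ContMDiffAt I I.tangent ∞ (fun y ↦ (⟨y, Y y⟩ : TangentBundle I M)) x) :
    ContMDiffAt I 𝓘(ℝ, ℝ) ∞ (fun y ↦ g y (X y) (Y y)) x := by
  have := ContMDiffAt.clm_bundle_apply₂ (E₃ := Bundle.Trivial M ℝ) (hg x) hX hY
  rw [contMDiffAt_totalSpace] at this
  exact this.2

theorem SmoothBilin.mdifferentiableAt_apply {g : BilinField I M} (hg : SmoothBilin g)
    {X Y : VField I M} (hX : DiffAt x X) (hY : DiffAt x Y) :
    MDifferentiableAt I 𝓘(ℝ, ℝ) (fun y ↦ g y (X y) (Y y)) x := by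
  have := MDifferentiableAt.clm_bundle_apply₂ (E₃ := Bundle.Trivial M ℝ)
    ((hg x).mdifferentiableAt (by simp)) hX hY
  rw [mdifferentiableAt_totalSpace] at this
  exact this.2

end Regularity

section Deformation

variable {E : Type*} [NormedAddCommGroup E] [NormedSpace ℝ E]
  {H : Type*} [TopologicalSpace H] {I : ModelWithCorners ℝ E H}
  {M : Type*} [TopologicalSpace M] [ChartedSpace H M] [IsManifold I ∞ M]
  {U : Set M} {x : M}

theorem IsConnectionOn.add_apply {D : Conn I M} (hD : IsConnectionOn U D) (hx : x ∈ U)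
    {Y Z : VField I M} (hY : DiffAt x Y) (hZ : DiffAt x Z) (u : TangentSpace I x) :
    D (Y + Z) x u = D Y x u + D Z x u := by
  rw [hD.isCov.add hY hZ hx]; rfl

theorem IsConnectionOn.smul_apply {D : Conn I M} (hD : IsConnectionOn U D) (hx : x ∈ U)
    {f : M → ℝ} {Y : VField I M} (hf : MDifferentiableAt I 𝓘(ℝ, ℝ) f x) (hY : DiffAt x Y)
    (u : TangentSpace I x) :
    D (f • Y) x u = f x • D Y x u + dirDeriv f x u • Y x := by
  rw [hD.isCov.leibniz hY hf hx]; rfl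

theorem DiffAt.add {Y Z : VField I M} (hY : DiffAt x Y) (hZ : DiffAt x Z) : DiffAt x (Y + Z) :=
  mdifferentiableAt_add_section hY hZ

theorem DiffAt.smul {f : M → ℝ} {Y : VField I M} (hf : MDifferentiableAt I 𝓘(ℝ, ℝ) f x)
    (hY : DiffAt x Y) : DiffAt x (f • Y) :=
  hf.smul_section hY

omit [IsManifold I ∞ M] in
theorem dirDeriv_neg (f : M → ℝ) (x : M) (u : TangentSpace I x) :
    dirDeriv (-f) x u = -dirDeriv f x u := by
  simp [dirDeriv, mvfderiv_neg]

/-- The data expressing that the connection `D` is obtained from a torsion-free metric connection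
`D'` of a degenerate metric `g` by
`D_X Y = D'_X Y + θ(X) Y + θ(Y) X - g(X, Y) T - S(X, Y) ξ`, where `T` is `g`-dual to `θ` and
`ξ` is a recurrent null field for `D'`, with recurrence form `φ`. -/
structure WeylDeformation (U : Set M) (g : BilinField I M) (θ φ : OneForm I M) (T ξ : VField I M)
    (S : Π x : M, TangentSpace I x →ₗ[ℝ] TangentSpace I x →ₗ[ℝ] ℝ) (D D' : Conn I M) : Prop where
  isOpen : IsOpen U
  conn : IsConnectionOn U D
  conn' : IsConnectionOn U D'
  torsionFree' : TorsionFreeOn U D'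
  metric' : MetricOn U D' g
  g_smooth : SmoothBilin g
  g_symm : ∀ x u v, g x u v = g x v u
  θ_smooth : SmoothForm Set.univ θ
  T_smooth : SmoothField U T
  ξ_smooth : SmoothField U ξ
  S_mdifferentiableAt : ∀ x ∈ U, ∀ X Y : VField I M, DiffAt x X → SmoothField U Y →
    MDifferentiableAt I 𝓘(ℝ, ℝ) (fun y ↦ S y (X y) (Y y)) x
  S_symm : ∀ x ∈ U, ∀ u v, S x u v = S x v u
  S_ξ_ξ : ∀ x ∈ U, S x (ξ x) (ξ x) = 0
  g_T : ∀ x ∈ U, ∀ u, g x (T x) u = θ x u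
  g_ξ : ∀ x ∈ U, ∀ u, g x (ξ x) u = 0
  θ_ξ : ∀ x ∈ U, θ x (ξ x) = 0
  conn'_ξ : ∀ x ∈ U, ∀ u, D' ξ x u = φ x u • ξ x
  φ_ξ : ∀ x ∈ U, φ x (ξ x) = 0
  decomp : ∀ x ∈ U, ∀ (Y : VField I M) (u : TangentSpace I x), DiffAt x Y →
    D Y x u = D' Y x u + θ x u • Y x + θ x (Y x) • u - g x u (Y x) • T x - S x u (Y x) • ξ x

variable {g : BilinField I M} {θ φ : OneForm I M} {T ξ : VField I M}
  {S : Π x : M, TangentSpace I x →ₗ[ℝ] TangentSpace I x →ₗ[ℝ] ℝ} {D D' : Conn I M}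

/-- The value at `(u, v)` of the difference tensor of a Weyl deformation. -/
def deformTensor (g : BilinField I M) (θ : OneForm I M) (T ξ : VField I M)
    (S : Π x : M, TangentSpace I x →ₗ[ℝ] TangentSpace I x →ₗ[ℝ] ℝ) (x : M)
    (u v : TangentSpace I x) : TangentSpace I x :=
  θ x u • v + θ x v • u - g x u v • T x - S x u v • ξ x

namespace WeylDeformation

theorem metric_apply (h : WeylDeformation U g θ φ T ξ S D D') (hx : x ∈ U) {X Y : VField I M}
    (hX : DiffAt x X) (hY : DiffAt x Y) (Z : VField I M) (hZ : DiffAt x Z) :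
    dirDeriv (fun y ↦ g y (X y) (Y y)) x (Z x)
      = g x (D' X x (Z x)) (Y x) + g x (X x) (D' Y x (Z x)) := by
  have := h.metric' x hx Z X Y hZ hX hY
  simp only [covDerivBilin] at this
  linarith

theorem conn_conn (h : WeylDeformation U g θ φ T ξ S D D') (hx : x ∈ U) {W Y : VField I M}
    (hW : DiffAt x W) (hY : SmoothField U Y) (u : TangentSpace I x) :
    D (fun y ↦ D Y y (W y)) x u = D' (fun y ↦ D' Y y (W y)) x u
      + dirDeriv (fun y ↦ θ y (W y)) x u • Y x + θ x (W x) • D' Y x u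
      + dirDeriv (fun y ↦ θ y (Y y)) x u • W x + θ x (Y x) • D' W x u
      - dirDeriv (fun y ↦ g y (W y) (Y y)) x u • T x - g x (W x) (Y x) • D' T x u
      - dirDeriv (fun y ↦ S y (W y) (Y y)) x u • ξ x - (S x (W x) (Y x) * φ x u) • ξ x
      + deformTensor g θ T ξ S x u (D' Y x (W x) + deformTensor g θ T ξ S x (W x) (Y x)) := by
  have hYd := hY.diffAt h.isOpen hx
  have hTd := h.T_smooth.diffAt h.isOpen hx
  have hξd := h.ξ_smooth.diffAt h.isOpen hx
  have h0 := h.conn'.diffAt h.isOpen hY hx hW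
  have f1 := h.θ_smooth.mdifferentiableAt_apply hW
  have f2 := h.θ_smooth.mdifferentiableAt_apply hYd
  have f3 := (h.g_smooth.mdifferentiableAt_apply hW hYd).neg
  have f4 := (h.S_mdifferentiableAt x hx W Y hW hY).neg
  have d1 := DiffAt.smul f1 hYd
  have d2 := DiffAt.smul f2 hW
  have d3 := DiffAt.smul f3 hTd
  have d4 := DiffAt.smul f4 hξd
  have e1 := h.decomp x hx _ u (h.conn.diffAt h.isOpen hY hx hW)
  have e2 := h.conn'.isCov.congr_of_eventuallyEq (x := x) (σ := fun y ↦ D Y y (W y))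
    (h.conn.diffAt h.isOpen hY hx hW) (((((h0.add d1).add d2).add d3).add d4))
    (h.isOpen.mem_nhds hx) (by
      filter_upwards [h.isOpen.mem_nhds hx] with y hy
      rw [h.decomp y hy Y (W y) (hY.diffAt h.isOpen hy)]
      simp only [Pi.add_apply, Pi.smul_apply', Pi.neg_apply]
      module)
  rw [e1, e2, h.conn'.add_apply hx (((h0.add d1).add d2).add d3) d4,
    h.conn'.add_apply hx ((h0.add d1).add d2) d3, h.conn'.add_apply hx (h0.add d1) d2,
    h.conn'.add_apply hx h0 d1, h.conn'.smul_apply hx f1 hYd, h.conn'.smul_apply hx f2 hW,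
    h.conn'.smul_apply hx f3 hTd, h.conn'.smul_apply hx f4 hξd, dirDeriv_neg, dirDeriv_neg,
    h.decomp x hx Y (W x) hYd, h.conn'_ξ x hx]
  simp only [deformTensor, Pi.neg_apply, map_add, map_sub, map_smul]
  module

theorem curvature_eq (h : WeylDeformation U g θ φ T ξ S D D') (hx : x ∈ U) {X Y Z : VField I M}
    (hX : SmoothField U X) (hY : SmoothField U Y) (hZ : DiffAt x Z) :
    curvature D X Z Y x = curvature D' X Z Y x
      + covDerivForm D' θ Z X x • Y x + covDerivForm D' θ Z Y x • X x
      - g x (X x) (Y x) • D' T x (Z x)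
      - covDerivBilin D' (fun y u v ↦ S y u v) Z X Y x • ξ x
      - (S x (X x) (Y x) * φ x (Z x)) • ξ x
      - covDerivForm D' θ X Z x • Y x - covDerivForm D' θ X Y x • Z x
      + g x (Z x) (Y x) • D' T x (X x)
      + covDerivBilin D' (fun y u v ↦ S y u v) X Z Y x • ξ x
      + (S x (Z x) (Y x) * φ x (X x)) • ξ x
      + deformTensor g θ T ξ S x (Z x) (deformTensor g θ T ξ S x (X x) (Y x))
      - deformTensor g θ T ξ S x (X x) (deformTensor g θ T ξ S x (Z x) (Y x)) := by
  have hXd := hX.diffAt h.isOpen hx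
  have hYd := hY.diffAt h.isOpen hx
  simp only [curvature, covDerivForm, covDerivBilin]
  rw [h.conn_conn hx hZ hY, h.conn_conn hx hXd hY, h.decomp x hx Y _ hYd,
    ← h.torsionFree' x hx X Z hXd hZ, h.metric_apply hx hZ hYd X hXd,
    h.metric_apply hx hXd hYd Z hZ]
  simp only [deformTensor, map_add, map_sub, map_smul, LinearMap.sub_apply, sub_apply]
  module

end WeylDeformation

end Deformation

section Trace

variable {E : Type*} [NormedAddCommGroup E] [NormedSpace ℝ E]
  {H : Type*} [TopologicalSpace H] {I : ModelWithCorners ℝ E H}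
  {M : Type*} [TopologicalSpace M] [ChartedSpace H M] [IsManifold I ∞ M]
  {U : Set M} {x : M}
  {g : BilinField I M} {θ φ : OneForm I M} {T ξ : VField I M}
  {S : Π x : M, TangentSpace I x →ₗ[ℝ] TangentSpace I x →ₗ[ℝ] ℝ} {D D' : Conn I M}

/-- The endomorphism `u ↦ deformTensor g θ T ξ S x u v`. -/
def deformEndo (g : BilinField I M) (θ : OneForm I M) (T ξ : VField I M)
    (S : Π x : M, TangentSpace I x →ₗ[ℝ] TangentSpace I x →ₗ[ℝ] ℝ) (x : M)
    (v : TangentSpace I x) : TangentSpace I x →ₗ[ℝ] TangentSpace I x :=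
  (θ x : TangentSpace I x →ₗ[ℝ] ℝ).smulRight v + θ x v • LinearMap.id
    - (g x v : TangentSpace I x →ₗ[ℝ] ℝ).smulRight (T x)
    - ((S x).flip v).smulRight (ξ x)

omit [IsManifold I ∞ M] in
theorem deformEndo_apply (hg : ∀ x u v, g x u v = g x v u) (u v : TangentSpace I x) :
    deformEndo g θ T ξ S x v u = deformTensor g θ T ξ S x u v := by
  simp [deformEndo, deformTensor, hg x u v]

theorem covDerivForm_tensorial (hD : IsConnectionOn U D) (hx : x ∈ U)
    (hθ : SmoothForm Set.univ θ) (X : VField I M) :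
    TensorialAt I E (fun Z : Π y : M, TangentSpace I y ↦ covDerivForm D θ X Z x) x := by
  constructor
  · intro f Z hf hZ
    have e : (fun y ↦ θ y ((f • Z) y)) = f * fun y ↦ θ y (Z y) := by
      funext y; simp
    simp only [covDerivForm]
    rw [e, hD.smul_apply hx hf hZ, dirDeriv, mvfderiv_mul hf (hθ.mdifferentiableAt_apply hZ)]
    simp [dirDeriv]
    ring
  · intro Z Z' hZ hZ'
    have e : (fun y ↦ θ y ((Z + Z') y)) = (fun y ↦ θ y (Z y)) + fun y ↦ θ y (Z' y) := by
      funext y; simp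
    simp only [covDerivForm]
    rw [e, hD.add_apply hx hZ hZ', dirDeriv,
      mvfderiv_add (hθ.mdifferentiableAt_apply hZ) (hθ.mdifferentiableAt_apply hZ')]
    simp [dirDeriv]
    ring

theorem covDerivBilin_tensorial (hD : IsConnectionOn U D) (hx : x ∈ U) (X : VField I M)
    {Y : VField I M} (hS : ∀ Z : VField I M, DiffAt x Z →
      MDifferentiableAt I 𝓘(ℝ, ℝ) (fun y ↦ S y (Z y) (Y y)) x) :
    TensorialAt I E (fun Z : Π y : M, TangentSpace I y ↦
      covDerivBilin D (fun y u v ↦ S y u v) X Z Y x) x := by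
  constructor
  · intro f Z hf hZ
    have e : (fun y ↦ S y ((f • Z) y) (Y y)) = f * fun y ↦ S y (Z y) (Y y) := by
      funext y; simp
    simp only [covDerivBilin]
    rw [e, hD.smul_apply hx hf hZ, dirDeriv, mvfderiv_mul hf (hS Z hZ)]
    simp [dirDeriv]
    ring
  · intro Z Z' hZ hZ'
    have e : (fun y ↦ S y ((Z + Z') y) (Y y))
        = (fun y ↦ S y (Z y) (Y y)) + fun y ↦ S y (Z' y) (Y y) := by
      funext y; simp
    simp only [covDerivBilin]
    rw [e, hD.add_apply hx hZ hZ', dirDeriv, mvfderiv_add (hS Z hZ) (hS Z' hZ')]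
    simp [dirDeriv]
    ring

namespace WeylDeformation

theorem conn'_T (h : WeylDeformation U g θ φ T ξ S D D') (hx : x ∈ U) {X Y : VField I M}
    (hX : SmoothField U X) (hY : SmoothField U Y) :
    g x (D' T x (X x)) (Y x) = covDerivForm D' θ X Y x := by
  have hYd := hY.diffAt h.isOpen hx
  have hTd := h.T_smooth.diffAt h.isOpen hx
  have e := h.metric_apply hx hTd hYd X (hX.diffAt h.isOpen hx)
  have e' : dirDeriv (fun y ↦ g y (T y) (Y y)) x (X x)
      = dirDeriv (fun y ↦ θ y (Y y)) x (X x) := by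
    have : (fun y ↦ g y (T y) (Y y)) =ᶠ[𝓝 x] fun y ↦ θ y (Y y) := by
      filter_upwards [h.isOpen.mem_nhds hx] with y hy using h.g_T y hy _
    rw [dirDeriv, dirDeriv, mvfderiv, mvfderiv, this.mfderiv_eq]
    rfl
  rw [e', h.g_T x hx] at e
  rw [covDerivForm]
  linarith

theorem two_mul_extDerivHalf (h : WeylDeformation U g θ φ T ξ S D D') (hx : x ∈ U)
    {X Y : VField I M} (hX : SmoothField U X) (hY : SmoothField U Y) :
    2 * extDerivHalf θ X Y x = covDerivForm D' θ X Y x - covDerivForm D' θ Y X x := by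
  rw [extDerivHalf, ← h.torsionFree' x hx X Y (hX.diffAt h.isOpen hx) (hY.diffAt h.isOpen hx),
    covDerivForm, covDerivForm, map_sub]
  ring

variable [FiniteDimensional ℝ E]

theorem ricci_eq (h : WeylDeformation U g θ φ T ξ S D D') (hx : x ∈ U) {X Y : VField I M}
    (hX : SmoothField U X) (hY : SmoothField U Y) :
    ricci D X Y x = ricci D' X Y x - 2 * extDerivHalf θ X Y x
      + (2 - (Module.finrank ℝ E : ℝ)) * covDerivForm D' θ X Y x
      + ((Module.finrank ℝ E : ℝ) - 2) * (θ x (X x) * θ x (Y x))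
      + (2 - (Module.finrank ℝ E : ℝ)) * (g x (X x) (Y x) * g x (T x) (T x))
      - g x (X x) (Y x) * LinearMap.trace ℝ (TangentSpace I x)
        (D' T x : TangentSpace I x →ₗ[ℝ] TangentSpace I x)
      + ((covDerivBilin D' (fun y u v ↦ S y u v) X ξ Y x
          - covDerivBilin D' (fun y u v ↦ S y u v) ξ X Y x)
        + g x (X x) (Y x) * S x (ξ x) (T x)
        - S x (ξ x) (X x) * S x (ξ x) (Y x)
        + φ x (X x) * S x (ξ x) (Y x)) := by
  have hYd := hY.diffAt h.isOpen hx
  have t1 := covDerivForm_tensorial h.conn' hx h.θ_smooth X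
  have t2 := covDerivBilin_tensorial h.conn' hx X fun Z hZ ↦ h.S_mdifferentiableAt x hx Z Y hZ hY
  have m1 := TensorialAt.mkHom_apply t1 hYd
  have m2 := TensorialAt.mkHom_apply t2 (h.ξ_smooth.diffAt h.isOpen hx)
  have k1 (Z : VField I M) (hZ : DiffAt x Z) := TensorialAt.mkHom_apply t1 hZ
  have k2 (Z : VField I M) (hZ : DiffAt x Z) := TensorialAt.mkHom_apply t2 hZ
  set α := TensorialAt.mkHom _ x t1
  set β := TensorialAt.mkHom _ x t2
  set a : VField I M → (TangentSpace I x →L[ℝ] ℝ) := fun W ↦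
    mvfderiv I (fun y ↦ θ y (W y)) x - (θ x).comp (D' W x) with ha
  set b : TangentSpace I x →ₗ[ℝ] ℝ :=
    (mvfderiv I (fun y ↦ S y (X y) (Y y)) x : TangentSpace I x →ₗ[ℝ] ℝ)
      - (S x).flip (Y x) ∘ₗ (D' X x : TangentSpace I x →ₗ[ℝ] TangentSpace I x)
      - S x (X x) ∘ₗ (D' Y x : TangentSpace I x →ₗ[ℝ] TangentSpace I x) with hb
  have key : (ricciEndo D X Y x : TangentSpace I x →ₗ[ℝ] TangentSpace I x)
      = (ricciEndo D' X Y x : TangentSpace I x →ₗ[ℝ] TangentSpace I x)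
        + (a X : TangentSpace I x →ₗ[ℝ] ℝ).smulRight (Y x)
        + (a Y : TangentSpace I x →ₗ[ℝ] ℝ).smulRight (X x)
        - g x (X x) (Y x) • (D' T x : TangentSpace I x →ₗ[ℝ] TangentSpace I x)
        - b.smulRight (ξ x)
        - S x (X x) (Y x) • (φ x : TangentSpace I x →ₗ[ℝ] ℝ).smulRight (ξ x)
        - (α : TangentSpace I x →ₗ[ℝ] ℝ).smulRight (Y x)
        - covDerivForm D' θ X Y x • LinearMap.id
        + (g x (Y x) : TangentSpace I x →ₗ[ℝ] ℝ).smulRight (D' T x (X x))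
        + (β : TangentSpace I x →ₗ[ℝ] ℝ).smulRight (ξ x)
        + φ x (X x) • ((S x).flip (Y x)).smulRight (ξ x)
        + deformEndo g θ T ξ S x (deformTensor g θ T ξ S x (X x) (Y x))
        - (θ x (X x) • deformEndo g θ T ξ S x (Y x)
          + ((θ x : TangentSpace I x →ₗ[ℝ] ℝ) ∘ₗ deformEndo g θ T ξ S x (Y x)).smulRight (X x)
          - ((g x (X x) : TangentSpace I x →ₗ[ℝ] ℝ)
            ∘ₗ deformEndo g θ T ξ S x (Y x)).smulRight (T x)
          - (S x (X x) ∘ₗ deformEndo g θ T ξ S x (Y x)).smulRight (ξ x)) := by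
    ext v
    obtain ⟨Z, hZ, rfl⟩ : ∃ Z : VField I M, DiffAt x Z ∧ Z x = v :=
      ⟨FiberBundle.extend E v, FiberBundle.mdifferentiableAt_extend .., FiberBundle.extend_apply_self ..⟩
    have e := h.curvature_eq hx hX hY hZ
    rw [← ricciEndo_apply h.isOpen h.conn hX hY hx hZ,
      ← ricciEndo_apply h.isOpen h.conn' hX hY hx hZ] at e
    simp only [LinearMap.add_apply, LinearMap.sub_apply, LinearMap.smul_apply,
      LinearMap.smulRight_apply, LinearMap.comp_apply, ContinuousLinearMap.coe_coe,
      deformEndo_apply h.g_symm, LinearMap.id_apply, LinearMap.flip_apply, h.g_symm x (Y x)]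
    rw [e, k1 Z hZ, k2 Z hZ]
    simp only [ha, hb, covDerivForm, covDerivBilin, dirDeriv, LinearMap.sub_apply,
      LinearMap.comp_apply, LinearMap.flip_apply, ContinuousLinearMap.coe_coe, sub_apply,
      ContinuousLinearMap.comp_apply]
    rw [deformTensor.eq_def g θ T ξ S x (X x) (deformTensor g θ T ξ S x (Z x) (Y x))]
    module
  have : FiniteDimensional ℝ (TangentSpace I x) := inferInstanceAs (FiniteDimensional ℝ E)
  have hfr : Module.finrank ℝ (TangentSpace I x) = Module.finrank ℝ E := rfl
  have tr (v : TangentSpace I x) : LinearMap.trace ℝ (TangentSpace I x)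
      (deformEndo g θ T ξ S x v) = Module.finrank ℝ E * θ x v - S x (ξ x) v := by
    have : g x v (T x) = θ x v := by rw [h.g_symm, h.g_T x hx]
    simp only [deformEndo, map_add, map_sub, map_smul, LinearMap.trace_smulRight,
      LinearMap.trace_id, hfr, ContinuousLinearMap.coe_coe,
      LinearMap.flip_apply, this, smul_eq_mul]
    ring
  have b_ξ : b (ξ x) = covDerivBilin D' (fun y u v ↦ S y u v) ξ X Y x := rfl
  have a_X : a X (Y x) = covDerivForm D' θ Y X x := rfl
  have a_Y : a Y (X x) = covDerivForm D' θ X Y x := rfl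
  have g_T' (u) : g x u (T x) = θ x u := by rw [h.g_symm, h.g_T x hx]
  have g_ξ' (u) : g x u (ξ x) = 0 := by rw [h.g_symm, h.g_ξ x hx]
  have g_D : g x (Y x) (D' T x (X x)) = covDerivForm D' θ X Y x := by
    rw [h.g_symm, h.conn'_T hx hX hY]
  rw [ricci, ricci, h.two_mul_extDerivHalf hx hX hY, key]
  simp only [map_add, map_sub, map_smul, LinearMap.trace_smulRight, LinearMap.trace_id, hfr, tr,
    LinearMap.comp_apply, ContinuousLinearMap.coe_coe, deformEndo_apply h.g_symm, smul_eq_mul,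
    LinearMap.flip_apply, b_ξ, a_X, a_Y, m1, m2,
    g_D, h.φ_ξ x hx, deformTensor, h.θ_ξ x hx, h.S_ξ_ξ x hx, h.g_T x hx,
    h.g_ξ x hx, g_T', g_ξ', h.S_symm x hx (X x) (ξ x)]
  ring

end WeylDeformation

end Trace

theorem apply_inverse_apply_of_injective {F : Type*} [NormedAddCommGroup F] [NormedSpace ℝ F]
    [FiniteDimensional ℝ F] (A : F →L[ℝ] F →L[ℝ] ℝ) (hA : Function.Injective A)
    (α : F →L[ℝ] ℝ) : A (A.inverse α) = α := by
  have hdim : Module.finrank ℝ F = Module.finrank ℝ (F →L[ℝ] ℝ) := by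
    rw [← (LinearMap.toContinuousLinearMap (𝕜 := ℝ) (E := F) (F' := ℝ)).finrank_eq,
      Module.finrank_linearMap_self]
  let e : F ≃L[ℝ] F →L[ℝ] ℝ :=
    ((A : F →ₗ[ℝ] F →L[ℝ] ℝ).linearEquivOfInjective hA hdim).toContinuousLinearEquiv
  have he : A = e := by ext; rfl
  rw [he, ContinuousLinearMap.inverse_equiv]
  exact e.apply_symm_apply α

section Gram

variable {E : Type*} [NormedAddCommGroup E] [NormedSpace ℝ E]
  {H : Type*} [TopologicalSpace H] {I : ModelWithCorners ℝ E H}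
  {M : Type*} [TopologicalSpace M] [ChartedSpace H M]

theorem contMDiffAt_det {κ : Type*} [Fintype κ] [DecidableEq κ] {A : M → Matrix κ κ ℝ} {x : M}
    (hA : ∀ i j, ContMDiffAt I 𝓘(ℝ, ℝ) ∞ (fun y ↦ A y i j) x) :
    ContMDiffAt I 𝓘(ℝ, ℝ) ∞ (fun y ↦ (A y).det) x := by
  simp only [Matrix.det_apply']
  exact contMDiffAt_finsetSum fun σ _ ↦ contMDiffAt_const.mul
    (contMDiffAt_finsetProd fun i _ ↦ hA _ _)

variable [IsManifold I ∞ M] [FiniteDimensional ℝ E] {U : Set M}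

/-- The vector field dual to a smooth `1`-form with respect to a smooth nondegenerate field of
bilinear forms is smooth. -/
theorem smoothField_of_dual (hU : IsOpen U) {B : BilinField I M} {θ : OneForm I M}
    {T : VField I M}
    (hB : ∀ x ∈ U, ∀ X Y : VField I M,
      ContMDiffAt I I.tangent ∞ (fun y ↦ (⟨y, X y⟩ : TangentBundle I M)) x →
      ContMDiffAt I I.tangent ∞ (fun y ↦ (⟨y, Y y⟩ : TangentBundle I M)) x →
      ContMDiffAt I 𝓘(ℝ, ℝ) ∞ (fun y ↦ B y (X y) (Y y)) x)
    (hθ : SmoothForm Set.univ θ) (hinj : ∀ x ∈ U, Function.Injective (B x))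
    (hT : ∀ x ∈ U, B x (T x) = θ x) : SmoothField U T := by
  intro x hx
  apply ContMDiffAt.contMDiffWithinAt
  set e := trivializationAt E (TangentSpace I : M → Type _) x
  have hxe : x ∈ e.baseSet := FiberBundle.mem_baseSet_trivializationAt' x
  let b := Module.finBasis ℝ E
  let s := e.localFrame b
  have hs (i) : ContMDiffAt I I.tangent ∞ (fun y ↦ (⟨y, s i y⟩ : TangentBundle I M)) x :=
    contMDiffAt_localFrame_of_mem ∞ e b i hxe
  refine (contMDiffAt_iff_localFrameCoeff b hxe).2 fun i ↦ ?_
  let A : M → Matrix _ _ ℝ := fun y ↦ Matrix.of fun j i ↦ B y (s i y) (s j y)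
  let w : M → _ → ℝ := fun y j ↦ θ y (s j y)
  let c : M → _ → ℝ := fun y i ↦ e.localFrameCoeff I b i y (T y)
  have hAs (j i) : ContMDiffAt I 𝓘(ℝ, ℝ) ∞ (fun y ↦ A y j i) x := hB x hx _ _ (hs i) (hs j)
  have hws (j) : ContMDiffAt I 𝓘(ℝ, ℝ) ∞ (fun y ↦ w y j) x := hθ.contMDiffAt_apply (hs j)
  have hdet : ∀ y ∈ U ∩ e.baseSet, (A y).det ≠ 0 := by
    intro y hy h0
    obtain ⟨v, hv, hv0⟩ := Matrix.exists_mulVec_eq_zero_iff.2 h0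
    have hsy (i) : s i y = e.basisAt b hy.2 i := e.localFrame_apply_of_mem_baseSet b hy.2
    have h1 : B y (∑ i, v i • s i y) = 0 := by
      ext u
      have : ∀ j, B y (∑ i, v i • s i y) (e.basisAt b hy.2 j) = 0 := fun j ↦ by
        have := congrFun hv0 j
        simp only [Matrix.mulVec, dotProduct, A, Matrix.of_apply, Pi.zero_apply] at this
        rw [← this, ← hsy]
        simp [mul_comm]
      have h2 := (e.basisAt b hy.2).ext (f₁ := (B y (∑ i, v i • s i y) : TangentSpace I y →ₗ[ℝ] ℝ))
        (f₂ := 0) this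
      exact LinearMap.congr_fun h2 u
    have h2 : ∑ i, v i • e.basisAt b hy.2 i = 0 := by
      simp only [← hsy]
      exact hinj y hy.1 (by rw [h1, map_zero])
    exact hv (funext fun i ↦ Fintype.linearIndependent_iff.1
      (e.basisAt b hy.2).linearIndependent v h2 i)
  have hc : ∀ y ∈ U ∩ e.baseSet, c y i = (A y).cramer (w y) i / (A y).det := by
    intro y hy
    have h1 : (A y).mulVec (c y) = w y := by
      funext j
      have h2 : T y = ∑ i, c y i • s i y := e.eq_sum_localFrameCoeff_smul hy.2
      change _ = θ y (s j y)
      rw [← hT y hy.1, h2]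
      simp [Matrix.mulVec, dotProduct, A, mul_comm]
    rw [eq_div_iff (hdet y hy), Matrix.cramer_eq_adjugate_mulVec, ← h1, Matrix.mulVec_mulVec,
      Matrix.adjugate_mul, Matrix.smul_mulVec, Matrix.one_mulVec]
    simp [mul_comm]
  have hsm : ContMDiffAt I 𝓘(ℝ, ℝ) ∞ (fun y ↦ (A y).cramer (w y) i / (A y).det) x := by
    refine ContMDiffAt.div₀ ?_ (contMDiffAt_det hAs) (hdet x ⟨hx, hxe⟩)
    simp only [Matrix.cramer_apply]
    refine contMDiffAt_det fun j k ↦ ?_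
    by_cases hk : k = i
    · subst hk; simpa using hws j
    · simpa [Matrix.updateCol_apply, hk] using hAs j k
  refine hsm.congr_of_eventuallyEq ?_
  filter_upwards [hU.mem_nhds hx, e.open_baseSet.mem_nhds hxe] with y h1 h2
  exact hc y ⟨h1, h2⟩

end Gram

section Null

variable {E : Type*} [NormedAddCommGroup E] [NormedSpace ℝ E]
  {H : Type*} [TopologicalSpace H] {I : ModelWithCorners ℝ E H}
  {M : Type*} [TopologicalSpace M] [ChartedSpace H M] [IsManifold I ∞ M]
  {U : Set M} {x : M} {g : BilinField I M} {θ : OneForm I M} {ξ : VField I M} {D D' : Conn I M}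

theorem MetricOn.weylRelationOn (h : MetricOn U D g) : WeylRelationOn U D g 0 := by
  intro x hx X Y Z hX hY hZ
  simpa using h x hx X Y Z hX hY hZ

theorem exists_diffAt_eq (v : TangentSpace I x) : ∃ Z : VField I M, DiffAt x Z ∧ Z x = v :=
  ⟨FiberBundle.extend E v, FiberBundle.mdifferentiableAt_extend ..,
    FiberBundle.extend_apply_self ..⟩

theorem WeylRelationOn.conn_null (h : WeylRelationOn U D g θ) (hU : IsOpen U) (hx : x ∈ U)
    (hξ : DiffAt x ξ) (hg : ∀ y ∈ U, ∀ u, g y (ξ y) u = 0) (u v : TangentSpace I x) :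
    g x (D ξ x u) v = 0 := by
  obtain ⟨X, hX, rfl⟩ := exists_diffAt_eq u
  obtain ⟨Z, hZ, rfl⟩ := exists_diffAt_eq v
  have e := h x hx X ξ Z hX hξ hZ
  have e0 : dirDeriv (fun y ↦ g y (ξ y) (Z y)) x (X x) = 0 := by
    have : (fun y ↦ g y (ξ y) (Z y)) =ᶠ[𝓝 x] fun _ ↦ (0 : ℝ) := by
      filter_upwards [hU.mem_nhds hx] with y hy using hg y hy _
    have e1 : dirDeriv (fun y ↦ g y (ξ y) (Z y)) x = dirDeriv (I := I) (fun _ ↦ (0 : ℝ)) x := by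
      funext w
      rw [dirDeriv, dirDeriv, mvfderiv, mvfderiv, this.mfderiv_eq]
      rfl
    rw [e1, dirDeriv, mvfderiv_const]
    rfl
  rw [covDerivBilin, e0, hg x hx, hg x hx] at e
  linarith

theorem WeylRelationOn.lie_null (h : WeylRelationOn U D g θ) (ht : TorsionFreeOn U D)
    (hs : ∀ x u v, g x u v = g x v u) (hU : IsOpen U) (hx : x ∈ U)
    (hξ : DiffAt x ξ) (hg : ∀ y ∈ U, ∀ u, g y (ξ y) u = 0) {Y Z : VField I M}
    (hY : DiffAt x Y) (hZ : DiffAt x Z) :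
    dirDeriv (fun y ↦ g y (Y y) (Z y)) x (ξ x) - g x (mlieBracket I ξ Y x) (Z x)
      - g x (Y x) (mlieBracket I ξ Z x) = -2 * θ x (ξ x) * g x (Y x) (Z x) := by
  have e := h x hx ξ Y Z hξ hY hZ
  rw [← e, covDerivBilin, ← ht x hx ξ Y hξ hY, ← ht x hx ξ Z hξ hZ, map_sub, map_sub,
    sub_apply, hs x (Y x) (D ξ x (Z x)), h.conn_null hU hx hξ hg, h.conn_null hU hx hξ hg]
  ring

theorem WeylRelationOn.apply_null_mul (h : WeylRelationOn U D g θ) (ht : TorsionFreeOn U D)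
    (h' : MetricOn U D' g) (ht' : TorsionFreeOn U D')
    (hs : ∀ x u v, g x u v = g x v u) (hU : IsOpen U) (hx : x ∈ U)
    (hξ : DiffAt x ξ) (hg : ∀ y ∈ U, ∀ u, g y (ξ y) u = 0) (u v : TangentSpace I x) :
    θ x (ξ x) * g x u v = 0 := by
  obtain ⟨Y, hY, rfl⟩ := exists_diffAt_eq u
  obtain ⟨Z, hZ, rfl⟩ := exists_diffAt_eq v
  have e := h.lie_null ht hs hU hx hξ hg hY hZ
  rw [h'.weylRelationOn.lie_null ht' hs hU hx hξ hg hY hZ] at e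
  simp at e
  rcases e with e | e <;> simp [e]

theorem conn_sub_conn_symm (ht : TorsionFreeOn U D) (ht' : TorsionFreeOn U D') (hx : x ∈ U)
    {X Y : VField I M} (hX : DiffAt x X) (hY : DiffAt x Y) :
    D Y x (X x) - D' Y x (X x) = D X x (Y x) - D' X x (Y x) := by
  have := (ht x hx X Y hX hY).trans (ht' x hx X Y hX hY).symm
  rw [sub_eq_sub_iff_add_eq_add] at this ⊢
  rw [this]; abel

variable {T : VField I M}

/-- The difference of a Weyl connection and a metric connection, both torsion-free, is determined
by the Weyl form up to the kernel of `g`. -/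
theorem WeylRelationOn.conn_sub_mem_ker (h : WeylRelationOn U D g θ) (ht : TorsionFreeOn U D)
    (h' : MetricOn U D' g) (ht' : TorsionFreeOn U D') (hs : ∀ x u v, g x u v = g x v u)
    (hx : x ∈ U) (hT : ∀ u, g x (T x) u = θ x u) {X Y : VField I M} (hX : DiffAt x X)
    (hY : DiffAt x Y) (w : TangentSpace I x) :
    g x (D Y x (X x) - D' Y x (X x) - θ x (X x) • Y x - θ x (Y x) • X x
      + g x (X x) (Y x) • T x) w = 0 := by
  obtain ⟨Z, hZ, rfl⟩ := exists_diffAt_eq w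
  have key {A B C : VField I M} (hA : DiffAt x A) (hB : DiffAt x B) (hC : DiffAt x C) :
      g x (D B x (A x) - D' B x (A x)) (C x) + g x (D C x (A x) - D' C x (A x)) (B x)
        = 2 * θ x (A x) * g x (B x) (C x) := by
    have e := h x hx A B C hA hB hC
    have e' := h' x hx A B C hA hB hC
    simp only [covDerivBilin] at e e'
    rw [map_sub, map_sub, sub_apply, sub_apply, hs x (D C x (A x)), hs x (D' C x (A x))]
    linarith
  have k1 := key hX hY hZ
  have k2 := key hY hZ hX
  have k3 := key hZ hX hY
  rw [conn_sub_conn_symm ht ht' hx hX hZ] at k1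
  rw [conn_sub_conn_symm ht ht' hx hY hX] at k2
  rw [conn_sub_conn_symm ht ht' hx hZ hY] at k3
  simp only [map_add, map_sub, map_smul, add_apply, sub_apply, smul_apply, smul_eq_mul, hT]
    at k1 k2 k3 ⊢
  rw [hs x (Z x) (X x)] at k2
  linarith

end Null

section Construction

variable {E : Type*} [NormedAddCommGroup E] [NormedSpace ℝ E] [FiniteDimensional ℝ E]
  {H : Type*} [TopologicalSpace H] {I : ModelWithCorners ℝ E H}
  {M : Type*} [TopologicalSpace M] [ChartedSpace H M] [IsManifold I ∞ M]
  {U : Set M} {x : M} {g : BilinField I M} {θ η : OneForm I M} {ξ : VField I M} {D D' : Conn I M}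

/-- `weylS` as a field of bilinear maps. -/
def weylSBilin (hD : IsConnectionOn U D) (hD' : IsConnectionOn U D') (g : BilinField I M)
    (η θ : OneForm I M) (x : M) : TangentSpace I x →ₗ[ℝ] TangentSpace I x →ₗ[ℝ] ℝ :=
  LinearMap.mk₂ ℝ (weylS hD hD' g η θ x)
    (fun u u' v ↦ by simp only [weylS, map_add, map_sub, map_smul, add_apply, smul_eq_mul]; ring)
    (fun c u v ↦ by simp only [weylS, map_add, map_sub, map_smul, smul_apply, smul_eq_mul]; ring)
    (fun u v v' ↦ by simp only [weylS, map_add, map_sub, map_smul, add_apply, smul_eq_mul]; ring)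
    (fun c u v ↦ by simp only [weylS, map_add, map_sub, map_smul, smul_apply, smul_eq_mul]; ring)

theorem weylS_apply (hD : IsConnectionOn U D) (hD' : IsConnectionOn U D') (hx : x ∈ U)
    (u : TangentSpace I x) {Y : VField I M} (hY : DiffAt x Y) :
    weylS hD hD' g η θ x u (Y x) = -η x (D Y x u - D' Y x u - θ x u • Y x - θ x (Y x) • u
      + g x u (Y x) • sharp g η θ x) := by
  rw [weylS, hD.isCov.difference_apply hD'.isCov hx hY]
  rfl

/-- A `1`-form which sends smooth fields to smooth functions, and differentiable fields to
differentiable functions, over `U`. -/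
structure RegularForm (U : Set M) (η : OneForm I M) : Prop where
  contMDiffAt : ∀ x ∈ U, ∀ X : VField I M,
    ContMDiffAt I I.tangent ∞ (fun y ↦ (⟨y, X y⟩ : TangentBundle I M)) x →
      ContMDiffAt I 𝓘(ℝ, ℝ) ∞ (fun y ↦ η y (X y)) x
  mdifferentiableAt : ∀ x ∈ U, ∀ X : VField I M, DiffAt x X →
    MDifferentiableAt I 𝓘(ℝ, ℝ) (fun y ↦ η y (X y)) x

/-- The field `ξ` spans the kernel of `g` over `U`, and `η(ξ) = 1`. -/
structure SpansKernel (U : Set M) (g : BilinField I M) (η : OneForm I M) (ξ : VField I M) :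
    Prop where
  null : ∀ x ∈ U, ∀ u, g x (ξ x) u = 0
  eta : ∀ x ∈ U, η x (ξ x) = 1
  eq_smul : ∀ x ∈ U, ∀ u, (∀ v, g x u v = 0) → u = η x u • ξ x

omit [IsManifold I ∞ M] in
theorem SpansKernel.flat_sharp (h : SpansKernel U g η ξ) (hs : ∀ x u v, g x u v = g x v u)
    (hx : x ∈ U) : Function.Injective (flat g η x) ∧ flat g η x (sharp g η θ x) = θ x := by
  have hinj : Function.Injective (flat g η x) := by
    refine (injective_iff_map_eq_zero (flat g η x)).2 fun u hu ↦ ?_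
    have e (v) : g x u v + η x u * η x v = 0 := by
      have := congrArg (fun α : TangentSpace I x →L[ℝ] ℝ ↦ α v) hu
      simpa [flat, mul_comm] using this
    have e0 : η x u = 0 := by
      have := e (ξ x)
      rwa [hs, h.null x hx, h.eta x hx, zero_add, mul_one] at this
    have := h.eq_smul x hx u fun v ↦ by simpa [e0] using e v
    rw [this, e0, zero_smul]
  exact ⟨hinj, apply_inverse_apply_of_injective (F := E) (flat g η x) hinj (θ x)⟩

omit [IsManifold I ∞ M] in
theorem SpansKernel.sharp_spec (h : SpansKernel U g η ξ) (hs : ∀ x u v, g x u v = g x v u)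
    (hθ : ∀ x ∈ U, θ x (ξ x) = 0) (hx : x ∈ U) :
    η x (sharp g η θ x) = 0 ∧ ∀ u, g x (sharp g η θ x) u = θ x u := by
  have e (v) : g x (sharp g η θ x) v + η x (sharp g η θ x) * η x v = θ x v := by
    have := congrArg (fun α : TangentSpace I x →L[ℝ] ℝ ↦ α v) (h.flat_sharp (θ := θ) hs hx).2
    simpa [flat, mul_comm] using this
  have e0 : η x (sharp g η θ x) = 0 := by
    have := e (ξ x)
    rwa [hs, h.null x hx, h.eta x hx, zero_add, mul_one, hθ x hx] at this
  exact ⟨e0, fun u ↦ by simpa [e0] using e u⟩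

/-- A torsion-free Weyl connection is a Weyl deformation of any adapted connection. -/
theorem weylDeformation (hU : IsOpen U) (hD : IsConnectionOn U D) (ht : TorsionFreeOn U D)
    (hW : WeylRelationOn U D g θ) (hD' : IsAdaptedConnection U g ξ D') (hg : SmoothBilin g)
    (hs : ∀ x u v, g x u v = g x v u) (hθ : SmoothForm Set.univ θ) (hξ : SmoothField U ξ)
    (hη : RegularForm U η) (hker : SpansKernel U g η ξ) (hθξ : ∀ x ∈ U, θ x (ξ x) = 0)
    (hDξ : ∀ x ∈ U, D ξ x (ξ x) = 0) :
    WeylDeformation U g θ (phi D' η ξ) (sharp g η θ) ξ (weylSBilin hD hD'.isConn g η θ) D D' := by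
  have hTs : SmoothField U (sharp g η θ) := by
    refine smoothField_of_dual hU (B := fun x ↦ flat g η x) (fun x hx X Y hX hY ↦ ?_) hθ
      (fun x hx ↦ (hker.flat_sharp (θ := θ) hs hx).1) (fun x hx ↦ (hker.flat_sharp hs hx).2)
    have := (hg.contMDiffAt_apply hX hY).add
      ((hη.contMDiffAt x hx X hX).mul (hη.contMDiffAt x hx Y hY))
    refine this.congr_of_eventuallyEq (.of_forall fun y ↦ ?_)
    simp [flat]
  exact {
    isOpen := hU
    conn := hD
    conn' := hD'.isConn
    torsionFree' := hD'.torsionFree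
    metric' := hD'.metric
    g_smooth := hg
    g_symm := hs
    θ_smooth := hθ
    T_smooth := hTs
    ξ_smooth := hξ
    S_mdifferentiableAt := fun x hx X Y hX hY ↦ by
      have hYd := hY.diffAt hU hx
      have f1 := (hθ.mdifferentiableAt_apply hX).neg
      have f2 := (hθ.mdifferentiableAt_apply hYd).neg
      have f3 := hg.mdifferentiableAt_apply hX hYd
      have d := ((((hD.diffAt hU hY hx hX).add (DiffAt.smul mdifferentiableAt_const
        (hD'.isConn.diffAt hU hY hx hX) : DiffAt x ((fun _ ↦ (-1 : ℝ)) • _))).add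
        (DiffAt.smul f1 hYd)).add (DiffAt.smul f2 hX)).add
        (DiffAt.smul f3 (hTs.diffAt hU hx))
      refine (hη.mdifferentiableAt x hx _ d).neg.congr_of_eventuallyEq ?_
      filter_upwards [hU.mem_nhds hx] with y hy
      refine (weylS_apply hD hD'.isConn hy (X y) (hY.diffAt hU hy)).trans ?_
      simp [sub_eq_add_neg]
    S_symm := fun x hx u v ↦ by
      obtain ⟨X, hX, rfl⟩ := exists_diffAt_eq u
      obtain ⟨Y, hY, rfl⟩ := exists_diffAt_eq v
      refine (weylS_apply hD hD'.isConn hx (X x) hY).trans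
        (Eq.trans ?_ (weylS_apply hD hD'.isConn hx (Y x) hX).symm)
      rw [conn_sub_conn_symm ht hD'.torsionFree hx hX hY, hs x (X x)]
      congr 2
      abel
    S_ξ_ξ := fun x hx ↦ by
      refine (weylS_apply hD hD'.isConn hx (ξ x) (hξ.diffAt hU hx)).trans ?_
      simp [hDξ x hx, hD'.geodesic x hx, hθξ x hx, hker.null x hx]
    g_T := fun x hx ↦ (hker.sharp_spec hs hθξ hx).2
    g_ξ := hker.null
    θ_ξ := hθξ
    conn'_ξ := fun x hx u ↦ hker.eq_smul x hx _
      (hD'.metric.weylRelationOn.conn_null hU hx (hξ.diffAt hU hx) hker.null u)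
    φ_ξ := fun x hx ↦ by simp [phi, hD'.geodesic x hx]
    decomp := fun x hx Y u hY ↦ by
      obtain ⟨X, hX, rfl⟩ := exists_diffAt_eq u
      have e := hker.eq_smul x hx _ (hW.conn_sub_mem_ker ht hD'.metric hD'.torsionFree hs hx
        (hker.sharp_spec hs hθξ hx).2 hX hY)
      have e1 : weylSBilin hD hD'.isConn g η θ x (X x) (Y x) = _ :=
        weylS_apply hD hD'.isConn hx (X x) hY
      rw [e1, neg_smul, ← e]
      abel }

end Construction

section Hypersurface

variable {E : Type*} [NormedAddCommGroup E] [NormedSpace ℝ E]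
  {H : Type*} [TopologicalSpace H] {I : ModelWithCorners ℝ E H}
  {M : Type*} [TopologicalSpace M] [ChartedSpace H M] [IsManifold I ∞ M]
  {E' : Type*} [NormedAddCommGroup E'] [NormedSpace ℝ E']
  {H' : Type*} [TopologicalSpace H'] {J : ModelWithCorners ℝ E' H'}
  {M' : Type*} [TopologicalSpace M'] [ChartedSpace H' M'] [IsManifold J ∞ M']
  {U : Set M} {g' : BilinField J M'} {ι : M → M'} {g₀ g : BilinField I M}

theorem regularForm_eta (hg' : SmoothBilin g') (hι : ContMDiff I J ∞ ι) (hU : IsOpen U)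
    {N : Π x : M, TangentSpace J (ι x)}
    (hN : ContMDiffOn I J.tangent ∞ (fun x ↦ (⟨ι x, N x⟩ : TangentBundle J M')) U) :
    RegularForm U (eta I g' ι N) where
  contMDiffAt x hx X hX := by
    have h1 : ContMDiffAt I J.tangent ∞
        (fun y ↦ (⟨ι y, mfderiv I J ι y (X y)⟩ : TangentBundle J M')) x :=
      ((hι.contMDiff_tangentMap (m := ∞) (by simp)) (⟨x, X x⟩ : TangentBundle I M)).comp x hX
    have h2 := ContMDiffAt.comp x (hg' (ι x)) (hι x)
    have := ContMDiffAt.clm_bundle_apply₂ (E₃ := Bundle.Trivial M' ℝ) h2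
      (hN.contMDiffAt (hU.mem_nhds hx)) h1
    rw [contMDiffAt_totalSpace] at this
    exact this.2
  mdifferentiableAt x hx X hX := by
    have h1 : MDifferentiableAt I J.tangent
        (fun y ↦ (⟨ι y, mfderiv I J ι y (X y)⟩ : TangentBundle J M')) x :=
      (((hι.contMDiff_tangentMap (m := ∞) (by simp)) (⟨x, X x⟩ : TangentBundle I M)
        ).mdifferentiableAt (by simp)).comp x hX
    have h2 := (ContMDiffAt.comp x (hg' (ι x)) (hι x)).mdifferentiableAt (by simp)
    have := MDifferentiableAt.clm_bundle_apply₂ (E₃ := Bundle.Trivial M' ℝ) h2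
      ((hN.contMDiffAt (hU.mem_nhds hx)).mdifferentiableAt (by simp)) h1
    rw [mdifferentiableAt_totalSpace] at this
    exact this.2

theorem IsLightlikeHypersurface.symm (h : IsLightlikeHypersurface g' ι g₀)
    (hg' : IsPseudoRiemannian g') (x : M) (u v : TangentSpace I x) : g₀ x u v = g₀ x v u := by
  rw [h.pullback, h.pullback, hg'.symm]

theorem smoothBilin_of_mem_nullConformalClass (h₀ : SmoothBilin g₀)
    (hg : g ∈ nullConformalClass g₀) : SmoothBilin g := by
  obtain ⟨f, hf, -, hfg⟩ := hg
  have he : ContMDiff I 𝓘(ℝ, ℝ) ∞ (fun x ↦ Real.exp (-2 * f x)) :=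
    Real.contDiff_exp.contMDiff.comp (contMDiff_const.mul hf)
  obtain rfl : g = fun x ↦ Real.exp (-2 * f x) • g₀ x := funext hfg
  exact fun x ↦ (he x).smul_section (h₀ x)

omit [IsManifold I ∞ M] in
theorem symm_of_mem_nullConformalClass (h₀ : ∀ x u v, g₀ x u v = g₀ x v u)
    (hg : g ∈ nullConformalClass g₀) (x : M) (u v : TangentSpace I x) :
    g x u v = g x v u := by
  obtain ⟨f, -, -, hfg⟩ := hg
  simp [hfg, h₀ x u v]

omit [IsManifold I ∞ M] in
theorem apply_eq_zero_iff_of_mem_nullConformalClass (hg : g ∈ nullConformalClass g₀) (x : M)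
    (u v : TangentSpace I x) : g x u v = 0 ↔ g₀ x u v = 0 := by
  obtain ⟨f, -, -, hfg⟩ := hg
  simp [hfg, Real.exp_ne_zero]

variable {Scr : Π x : M, Submodule ℝ (TangentSpace I x)} {ξ : VField I M}
  {N : Π x : M, TangentSpace J (ι x)}

theorem IsNormalizingPair.spansKernel (hN : IsNormalizingPair g' ι g₀ Scr U ξ N)
    (h : IsLightlikeHypersurface g' ι g₀) (hg : g ∈ nullConformalClass g₀) :
    SpansKernel U g (eta I g' ι N) ξ where
  null x hx u := by
    rw [apply_eq_zero_iff_of_mem_nullConformalClass hg]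
    exact congrArg (fun α : TangentSpace I x →L[ℝ] ℝ ↦ α u) (LinearMap.mem_ker.1 (hN.xi_rad x hx))
  eta x hx := hN.N_xi x hx
  eq_smul x hx u hu := by
    have hu' : u ∈ rad g₀ x := by
      refine LinearMap.mem_ker.2 (ContinuousLinearMap.ext fun v ↦ ?_)
      exact (apply_eq_zero_iff_of_mem_nullConformalClass hg x u v).1 (hu v)
    obtain ⟨c, hc⟩ := exists_smul_eq_of_finrank_eq_one (h.rank_rad x)
      (x := (⟨ξ x, hN.xi_rad x hx⟩ : rad g₀ x))
      (fun h0 ↦ hN.xi_ne_zero x hx (congrArg Subtype.val h0)) ⟨u, hu'⟩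
    obtain rfl : c • ξ x = u := congrArg Subtype.val hc
    have : eta I g' ι N x (ξ x) = 1 := hN.N_xi x hx
    rw [map_smul, this, smul_eq_mul, mul_one]

theorem IsNormalizingPair.mem_screen_of_eta_eq_zero {k : ℕ}
    (hN : IsNormalizingPair g' ι g₀ Scr U ξ N)
    (h : IsLightlikeHypersurface g' ι g₀) (hg : g ∈ nullConformalClass g₀)
    (hS : IsScreen k g₀ Scr) {x : M} (hx : x ∈ U) {u : TangentSpace I x}
    (hu : eta I g' ι N x u = 0) : u ∈ Scr x := by
  have hu' : u ∈ Scr x ⊔ rad g₀ x := (hS.isCompl x).sup_eq_top ▸ Submodule.mem_top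
  obtain ⟨w, hw, r, hr, rfl⟩ := Submodule.mem_sup.1 hu'
  have e := (hN.spansKernel h hg).eq_smul x hx r fun v ↦ by
    rw [apply_eq_zero_iff_of_mem_nullConformalClass hg]
    exact congrArg (fun α : TangentSpace I x →L[ℝ] ℝ ↦ α v) (LinearMap.mem_ker.1 hr)
  have e1 : eta I g' ι N x w = 0 := hN.N_screen x hx w hw
  rw [map_add, e1, zero_add] at hu
  rw [e, hu, zero_smul, add_zero]
  exact hw

omit [IsManifold J ∞ M'] in
/-- If `g₀` vanishes at one point, then `M` is one-dimensional and `g₀` vanishes identically. -/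
theorem IsLightlikeHypersurface.eq_zero [FiniteDimensional ℝ E]
    (h : IsLightlikeHypersurface g' ι g₀) {x : M} (hx : ∀ u v, g₀ x u v = 0) (y : M)
    (u v : TangentSpace I y) : g₀ y u v = 0 := by
  have hE : Module.finrank ℝ E = 1 := by
    have h1 : rad g₀ x = ⊤ := eq_top_iff.2 fun u _ ↦
      LinearMap.mem_ker.2 (ContinuousLinearMap.ext fun v ↦ hx u v)
    rw [← h.rank_rad x, h1]
    exact (finrank_top ℝ E).symm
  have : FiniteDimensional ℝ (TangentSpace I y) := inferInstanceAs (FiniteDimensional ℝ E)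
  have h2 : rad g₀ y = ⊤ := Submodule.eq_top_of_finrank_eq ((h.rank_rad y).trans hE.symm)
  have h3 : u ∈ rad g₀ y := h2 ▸ Submodule.mem_top
  exact congrArg (fun α : TangentSpace I y →L[ℝ] ℝ ↦ α v) (LinearMap.mem_ker.1 h3)

theorem smoothForm_zero : SmoothForm (I := I) (Set.univ : Set M) 0 :=
  (Bundle.contMDiff_zeroSection ℝ (fun x : M ↦ TangentSpace I x →L[ℝ] ℝ)).contMDiffOn

omit [IsManifold J ∞ M'] in
theorem IsWeylForm.apply_null [FiniteDimensional ℝ E] {D D' : Conn I M} {θ : OneForm I M}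
    (hθ : IsWeylForm D g θ) (hD : IsWeylStructure g₀ D) (hg : g ∈ nullConformalClass g₀)
    (h : IsLightlikeHypersurface g' ι g₀) (hs : ∀ x u v, g x u v = g x v u) (hU : IsOpen U)
    (hξ : SmoothField U ξ) (hξ0 : ∀ y ∈ U, ∀ u, g y (ξ y) u = 0) (ht' : TorsionFreeOn U D')
    (hm' : MetricOn U D' g) {x : M} (hx : x ∈ U) : θ x (ξ x) = 0 := by
  by_cases hgx : ∀ u v, g₀ x u v = 0
  · have h0 : ∀ y u v, g y u v = 0 := fun y u v ↦
      (apply_eq_zero_iff_of_mem_nullConformalClass hg y u v).2 (h.eq_zero hgx y u v)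
    have hW (θ' : OneForm I M) : WeylRelationOn Set.univ D g θ' := fun y _ X Y Z _ _ _ ↦ by
      simp [covDerivBilin, h0, dirDeriv, mvfderiv_const]
    rw [(hD.weyl g hg).unique ⟨hθ.smooth, hW θ⟩ ⟨smoothForm_zero, hW 0⟩]
    rfl
  · push Not at hgx
    obtain ⟨u, v, huv⟩ := hgx
    have e := WeylRelationOn.apply_null_mul (D := D) (θ := θ) (U := U)
      (fun y _ ↦ hθ.relation y (Set.mem_univ y)) (fun y _ ↦ hD.torsionFree y (Set.mem_univ y))
      hm' ht' hs hU hx (hξ.diffAt hU hx) hξ0 u v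
    exact (mul_eq_zero.1 e).resolve_right
      (mt (apply_eq_zero_iff_of_mem_nullConformalClass hg x u v).1 huv)

end Hypersurface

end WeylScreen

end

theorem mainTheorem7 (n : ℕ)
    -- the ambient pseudo-Riemannian manifold `(M', g')`, of dimension `n + 2`
    {M' : Type*} [TopologicalSpace M'] [T2Space M'] [SecondCountableTopology M']
    [ChartedSpace (EuclideanSpace ℝ (Fin (n + 2))) M'] [IsManifold (𝓡 (n + 2)) ∞ M']
    (g' : BilinField (𝓡 (n + 2)) M') (hg' : IsPseudoRiemannian g')
    (D' : Conn (𝓡 (n + 2)) M') (hD' : IsLeviCivita g' D')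
    -- the totally geodesic lightlike hypersurface `(M, g₀)`, with an integrable screen
    {M : Type*} [TopologicalSpace M] [T2Space M] [SecondCountableTopology M]
    [ChartedSpace (EuclideanSpace ℝ (Fin (n + 1))) M] [IsManifold (𝓡 (n + 1)) ∞ M]
    (ι : M → M') (g₀ : BilinField (𝓡 (n + 1)) M)
    (hM : IsLightlikeHypersurface g' ι g₀) (hgeo : IsTotallyGeodesic (𝓡 (n + 1)) D' ι)
    (Scr : Π x : M, Submodule ℝ (TangentSpace (𝓡 (n + 1)) x))
    (hScr : IsScreen n g₀ Scr) (hint : Integrable Scr)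
    -- the Weyl screen structure `D`, a metric `g` of the conformal structure, the form `θ_g`
    (D : Conn (𝓡 (n + 1)) M) (hD : IsWeylScreenStructure g₀ Scr D)
    (g : BilinField (𝓡 (n + 1)) M) (hg : g ∈ nullConformalClass g₀)
    (θ : OneForm (𝓡 (n + 1)) M) (hθ : IsWeylForm D g θ)
    -- a normalizing pair over an open set `U`, with `D_ξ ξ = 0`, and the connection `D^g`
    (U : Set M) (hU : IsOpen U)
    (ξ : VField (𝓡 (n + 1)) M) (N : Π x : M, TangentSpace (𝓡 (n + 2)) (ι x))
    (hN : IsNormalizingPair g' ι g₀ Scr U ξ N) (hξ : ∀ x ∈ U, D ξ x (ξ x) = 0)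
    (Dg : Conn (𝓡 (n + 1)) M) (hDg : IsAdaptedConnection U g ξ Dg) :
    let η : OneForm (𝓡 (n + 1)) M := eta (𝓡 (n + 1)) g' ι N
    let T : VField (𝓡 (n + 1)) M := sharp g η θ
    let φ : OneForm (𝓡 (n + 1)) M := phi Dg η ξ
    let S : Π x : M, TangentSpace (𝓡 (n + 1)) x → TangentSpace (𝓡 (n + 1)) x → ℝ :=
      weylS (hD.isConn.mono U) hDg.isConn g η θ
    -- properties of `θ_g`, its dual field `T`, `φ_g` and `S`, and the decomposition of `D`
    (∀ x ∈ U, θ x (ξ x) = 0 ∧ T x ∈ Scr x ∧ (∀ u, g x (T x) u = θ x u) ∧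
      (∀ u, Dg ξ x u = φ x u • ξ x) ∧ (∀ u v, S x u v = S x v u) ∧ S x (ξ x) (ξ x) = 0) ∧
    (∀ X Y : VField (𝓡 (n + 1)) M, ∀ x ∈ U, DiffAt x Y →
      D Y x (X x) = Dg Y x (X x) + θ x (X x) • Y x + θ x (Y x) • X x
        - g x (X x) (Y x) • T x - S x (X x) (Y x) • ξ x) ∧
    -- the Ricci curvature
    (∀ X Y : VField (𝓡 (n + 1)) M, SmoothField U X → SmoothField U Y → ∀ x ∈ U,
      ricci D X Y x = ricci Dg X Y x - 2 * extDerivHalf θ X Y x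
        + (1 - (n : ℝ)) * covDerivForm Dg θ X Y x
        + ((n : ℝ) - 1) * (θ x (X x) * θ x (Y x))
        + (1 - (n : ℝ)) * (g x (X x) (Y x) * g x (T x) (T x))
        - g x (X x) (Y x) * codiff Dg g η θ x
        + ((covDerivBilin Dg S X ξ Y x - covDerivBilin Dg S ξ X Y x)
          + g x (X x) (Y x) * S x (ξ x) (T x)
          - S x (ξ x) (X x) * S x (ξ x) (Y x)
          + φ x (X x) * S x (ξ x) (Y x))) := by
  intro η T φ S
  have hs := symm_of_mem_nullConformalClass (hM.symm hg') hg
  have hgs := smoothBilin_of_mem_nullConformalClass hM.smooth hg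
  have hker : SpansKernel U g η ξ := hN.spansKernel hM hg
  have hη : RegularForm U η := regularForm_eta hg'.smooth hM.immersion.contMDiff hU hN.N_smooth
  have hθξ (x) (hx : x ∈ U) : θ x (ξ x) = 0 := hθ.apply_null hD.toIsWeylStructure hg hM hs hU
    hN.xi_smooth hker.null hDg.torsionFree hDg.metric hx
  have h : WeylDeformation U g θ φ T ξ (weylSBilin (hD.isConn.mono U) hDg.isConn g η θ) D Dg :=
    weylDeformation hU (hD.isConn.mono U) (fun x _ ↦ hD.torsionFree x (Set.mem_univ x))
      (fun x _ ↦ hθ.relation x (Set.mem_univ x)) hDg hgs hs hθ.smooth hN.xi_smooth hη hker hθξ hξ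
  refine ⟨fun x hx ↦ ⟨hθξ x hx, ?_, h.g_T x hx, h.conn'_ξ x hx, h.S_symm x hx, h.S_ξ_ξ x hx⟩,
    fun X Y x hx hY ↦ h.decomp x hx Y (X x) hY, fun X Y hX hY x hx ↦ ?_⟩
  · exact hN.mem_screen_of_eta_eq_zero hM hg hScr hx (hker.sharp_spec hs hθξ hx).1
  · rw [h.ricci_eq hx hX hY, finrank_euclideanSpace_fin, codiff]
    push_cast
    rw [show (2 : ℝ) - (n + 1) = 1 - n by ring, show (n : ℝ) + 1 - 2 = n - 1 by ring]
    rfl
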